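/- **Consistency of the maximum likelihood estimator of the group proportions in the stochastic block model.** Let $Q\in\mathbb N$. A parameter is a pair $\theta=(\alpha,\pi)$ with $\alpha\in[0,1]^Q$, $\sum_q\alpha_q=1$, and $\pi\in[0,1]^{Q\times Q}$. Let $\theta^*=(\alpha^*,\pi^*)$ be a parameter such that, for some $\zeta>0$ and $0<\gamma<1/Q$, * (A1) for all $q\ne q'$ there is an $l$ with $\pi^*_{q,l}\neq\pi^*_{q',l}$ or $\pi^*_{l,q}\ne\pi^*_{l,q'}$; * (A2) for all $q,l$: $\pi^*_{q,l}\in(0,1)$ implies $\pi^*_{q,l}\in[\zeta,1-\zeta]$; * (A3) for all $q$: $\alpha^*_q\in[\gamma,1-\gamma]$. Let $(Z_i)_{i}$, $(X_{i,j})_{i,j}$ be a stochastic block model with parameter $\theta^*$ on countably many vertices: the labels $Z_i\in\{1,\dots,Q\}$ are i.i.d. with $\mathbb P(Z_i=q)=\alpha^*_q$; $X_{i,i}=0$; and, given the labels, the $X_{i,j}$, $i\neq j$, are independent Bernoulli variables with parameters $\pi^*_{Z_i,Z_j}$. Write $X_{[n]}=(X_{i,j})_{1\le i,j\le n}$ and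 let $$\mathcal L_2(X_{[n]};\alpha,\pi)=\log\Big(\sum_{z\in\{1,\dots,Q\}^n}\ \prod_{i\ne j}\pi_{z_i,z_j}^{X_{i,j}}(1-\pi_{z_i,z_j})^{1-X_{i,j}}\ \prod_{i=1}^n\alpha_{z_i}\Big)\in[-\infty,0]$$ (with $0^0=1$ and $\log 0=-\infty$) be the log-likelihood. Let $\Theta$ be any set of parameters that contains $\theta^*$ (for instance the set of all parameters, or the set of those satisfying (A1)–(A3) with the given $\zeta,\gamma$), and let $(\widehat\alpha,\widehat\pi)=(\widehat\alpha,\widehat\pi)(X_{[n]})$ be a maximum likelihood estimator over $\Theta$, that is, a function of $X_{[n]}$ which, with probability tending to $1$ as $n\to\infty$, belongs to $\Theta$ and maximizes $\mathcal L_2(X_{[n]};\cdot)$ over $\Theta$. Assume that $$\|\widehat\pi-\pi^*\|_\infty=o_{\mathbb P}\big(\sqrt{\log n}/n\big).$$ Let $\mathfrak S^{\pi^*}$ be the group of permutations $\sigma$ of $\{1,\dots,Q\}$ with $\pi^*_{\sigma(q),\sigma(l)}=\pi^*_{q,l}$ for all $q,l$, and write $\alpha^\sigma=(\alpha_{\sigma(q)})_q$.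 Then, for every distance $d$ on $\mathbb R^Q$ that induces the usual topology, $\widehat\alpha$ is consistent up to the relabellings of the classes that leave $\pi^*$ unchanged: $$\min_{\sigma\in\mathfrak S^{\pi^*}} d\big(\widehat\alpha^{\sigma},\alpha^*\big)\xrightarrow[n\to\infty]{\mathbb P}0 .$$ In particular, if $(\alpha^*)^\sigma=\alpha^*$ for every $\sigma\in\mathfrak S^{\pi^*}$ (for instance if $\mathfrak S^{\pi^*}=\{\mathrm{Id}\}$), then $$d(\widehat\alpha,\alpha^*)\xrightarrow[n\to\infty]{\mathbb P}0 .$$ -/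

import Mathlib

open Filter Topology MeasureTheory

namespace SBM

/-- A parameter `θ = (α, π)` of a stochastic block model with `Q` classes: `α q` is the probability
that a vertex belongs to class `q`, and `π q l` is the probability of an edge from a vertex of
class `q` to a vertex of class `l`. -/
structure Param (Q : ℕ) where
  α : Fin Q → ℝ
  π : Fin Q → Fin Q → ℝ

/-- `α` is a probability vector and the entries of `π` are probabilities. -/
structure Param.IsValid {Q : ℕ} (θ : Param Q) : Prop where
  α_nonneg : ∀ q, 0 ≤ θ.α q
  α_sum : ∑ q, θ.α q = 1
  π_mem : ∀ q l, θ.π q l ∈ Set.Icc (0 : ℝ) 1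

/-- Assumption (A1): distinct classes have distinct connectivity profiles. -/
def Param.A1 {Q : ℕ} (θ : Param Q) : Prop :=
  ∀ q q', q ≠ q' → ∃ l, θ.π q l ≠ θ.π q' l ∨ θ.π l q ≠ θ.π l q'

/-- Assumption (A2) with constant `ζ`: entries of `π` in `(0,1)` lie in `[ζ, 1 - ζ]`. -/
def Param.A2 {Q : ℕ} (θ : Param Q) (ζ : ℝ) : Prop :=
  ∀ q l, θ.π q l ∈ Set.Ioo (0 : ℝ) 1 → θ.π q l ∈ Set.Icc ζ (1 - ζ)

/-- Assumption (A3) with constant `γ`: no class is drained. -/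
def Param.A3 {Q : ℕ} (θ : Param Q) (γ : ℝ) : Prop :=
  ∀ q, θ.α q ∈ Set.Icc γ (1 - γ)

/-- The adjacency matrices of directed graphs on `n` vertices. -/
abbrev Adj (n : ℕ) : Type := Fin n → Fin n → Bool

/-- The probability `∏ i, α (z i)` of the label vector `z`. -/
noncomputable def labelProb {Q n : ℕ} (θ : Param Q) (z : Fin n → Fin Q) : ℝ :=
  ∏ i, θ.α (z i)

/-- The conditional likelihood of `x` given the labels `z`: the product over all `i ≠ j` of the
Bernoulli weights with parameter `π (z i) (z j)`. This is the exponential of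
`∑ i ≠ j, (x i j * log (π (z i) (z j)) + (1 - x i j) * log (1 - π (z i) (z j)))`,
with the conventions `log 0 = -∞`, `0 * log 0 = 0` and `exp (-∞) = 0`. -/
noncomputable def condLik {Q n : ℕ} (θ : Param Q) (x : Adj n) (z : Fin n → Fin Q) : ℝ :=
  ∏ i, ∏ j, if i = j then 1 else
    if x i j then θ.π (z i) (z j) else 1 - θ.π (z i) (z j)

/-- The log-likelihood of the observed adjacency matrix `x`, the labels being summed out.
It takes the value `-∞` where the likelihood vanishes. -/
noncomputable def logLik {Q n : ℕ} (x : Adj n) (θ : Param Q) : EReal :=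
  ENNReal.log (ENNReal.ofReal (∑ z : Fin n → Fin Q, condLik θ x z * labelProb θ z))

/-- `θ` is a maximum likelihood estimate over the parameter set `Θ` for the observation `x`. -/
def IsMLE {Q n : ℕ} (Θ : Set (Param Q)) (x : Adj n) (θ : Param Q) : Prop :=
  θ ∈ Θ ∧ IsMaxOn (logLik x) Θ θ

/-- The adjacency matrix of the subgraph on the first `n` vertices. -/
def restrict {Ω : Type*} (X : ℕ → ℕ → Ω → Bool) (n : ℕ) (ω : Ω) : Adj n :=
  fun i j => X i j ω

/-- `(Z, X)` is a stochastic block model with parameter `θ` under `μ`: there are no loops, the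
labels `Z i` are i.i.d. with distribution `α` and, given the labels, the `X i j`, `i ≠ j`, are
independent Bernoulli variables with parameters `π (Z i) (Z j)`. This is expressed by the joint
law of the labels and of the adjacency matrix of the first `n` vertices, for every `n`. -/
structure IsSBM {Ω : Type*} [MeasurableSpace Ω] {Q : ℕ} (μ : Measure Ω) (θ : Param Q)
    (Z : ℕ → Ω → Fin Q) (X : ℕ → ℕ → Ω → Bool) : Prop where
  measurable_label : ∀ i, Measurable (Z i)
  measurable_edge : ∀ i j, Measurable (X i j)
  no_loop : ∀ i ω, X i i ω = false
  law : ∀ (n : ℕ) (z : Fin n → Fin Q) (x : Adj n), (∀ i, x i i = false) →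
    μ {ω | (∀ i : Fin n, Z i ω = z i) ∧ restrict X n ω = x} =
      ENNReal.ofReal (labelProb θ z * condLik θ x z)

/-- The permutations of the classes that leave the connectivity matrix `π` invariant. -/
def symmetries {Q : ℕ} (π : Fin Q → Fin Q → ℝ) : Set (Equiv.Perm (Fin Q)) :=
  {σ | ∀ q l, π (σ q) (σ l) = π q l}

end SBM

/-! Fix the true labels `y` and split the label vectors `z` in the estimated likelihood into those
`near` `y` (up to a symmetry of π*, with at most ηn errors) and the far ones. Three facts hold with
probability tending to 1.

Far vectors are negligible. A far `z` mispredicts at least κ²n² edge probabilities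
(`le_mismatch_of_notMem_near`, where identifiability (A1) enters). Each costs a fixed factor in
Bhattacharyya affinity, while replacing π* by an estimate within δ costs only exp(2√δ n²)
(`sum_sqrt_condLik_le`). The resulting exp(-const · n²) beats both the Qⁿ choices of `z` and the
factor (γ/2)ⁿ⁻¹-type losses, all of which are exponential in n (`prob_far_le`).

Near vectors gain little. There are at most Q! exp(τn) of them (`card_near_le`), and for each the
likelihood maximized over π has polynomial total mass (`sum_condLik_le_of_isValid`). Hence their
total conditional likelihood is at most exp(2τn) times the true one (`prob_near_le`).

Class sizes are close to nα* (`prob_class_size_le`).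

Since the estimate has at least the likelihood of θ*, some near `z` has label probability above
exp(-3τn) times that of `y` under α* (`exists_near_of_lik_le`). Grouped by class, this says that the
Hellinger affinity of the relabelled estimate and α* is close to 1, so the two vectors are close
(`exists_symmetry_of_lik_le`). -/

namespace SBM

open Finset

variable {Q n : ℕ}

/-! ### Sums of products over loopless graphs -/

/-- The weight of a Bernoulli variable. -/
noncomputable def bern (p : ℝ) (b : Bool) : ℝ := if b then p else 1 - p

theorem bern_nonneg {p : ℝ} (hp : p ∈ Set.Icc (0 : ℝ) 1) (b : Bool) : 0 ≤ bern p b := by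
  cases b <;> simp [bern, hp.1, hp.2]

/-- The adjacency matrices without loops. -/
def loopless (n : ℕ) : Finset (Adj n) := univ.filter fun x => ∀ i, x i i = false

/-- A product of weights over the pairs of distinct vertices. -/
noncomputable def offDiagProd (w : Fin n → Fin n → Bool → ℝ) (x : Adj n) : ℝ :=
  ∏ i, ∏ j, if i = j then 1 else w i j (x i j)

theorem condLik_eq_offDiagProd (θ : Param Q) (x : Adj n) (z : Fin n → Fin Q) :
    condLik θ x z = offDiagProd (fun i j => bern (θ.π (z i) (z j))) x := rfl

theorem sum_pi_prod {ι κ : Type*} [Fintype ι] [DecidableEq ι] [Fintype κ] (g : ι → κ → ℝ) :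
    ∑ f : ι → κ, ∏ i, g i (f i) = ∏ i, ∑ k, g i k := by
  rw [Finset.prod_univ_sum, Fintype.piFinset_univ]

theorem sum_loopless_offDiagProd (w : Fin n → Fin n → Bool → ℝ) :
    ∑ x ∈ loopless n, offDiagProd w x =
      ∏ i, ∏ j, if i = j then 1 else w i j true + w i j false := by
  -- The absence of loops becomes a 0/1 factor on the diagonal, so that the sum over all adjacency
  -- matrices factorizes over pairs.
  have key : ∀ x : Adj n, (if ∀ i, x i i = false then offDiagProd w x else 0) =
      ∏ i, ∏ j, if i = j then (if x i j then 0 else 1) else w i j (x i j) := by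
    intro x
    split_ifs with h
    · refine prod_congr rfl fun i _ => prod_congr rfl fun j _ => ?_
      split_ifs with hij h'
      · subst hij; simp [h] at h'
      · rfl
      · rfl
    · push Not at h
      obtain ⟨i, hi⟩ := h
      symm
      refine prod_eq_zero (mem_univ i) (prod_eq_zero (mem_univ i) ?_)
      simpa using hi
  rw [loopless, sum_filter, sum_congr rfl fun x _ => key x]
  rw [sum_pi_prod (fun i (r : Fin n → Bool) =>
    ∏ j, if i = j then (if r j then (0 : ℝ) else 1) else w i j (r j))]
  refine prod_congr rfl fun i _ => ?_
  rw [sum_pi_prod (fun j b => if i = j then (if b then (0 : ℝ) else 1) else w i j b)]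
  refine prod_congr rfl fun j _ => ?_
  split_ifs <;> simp

theorem offDiagProd_le {w w' : Fin n → Fin n → Bool → ℝ} (x : Adj n)
    (h0 : ∀ i j b, 0 ≤ w i j b) (h : ∀ i j b, w i j b ≤ w' i j b) :
    offDiagProd w x ≤ offDiagProd w' x := by
  refine prod_le_prod (fun i _ => prod_nonneg fun j _ => ?_) fun i _ =>
    prod_le_prod (fun j _ => ?_) fun j _ => ?_
  all_goals split_ifs
  all_goals first | exact zero_le_one | exact le_rfl | exact h0 _ _ _ | exact h _ _ _

theorem offDiagProd_nonneg {w : Fin n → Fin n → Bool → ℝ} (x : Adj n)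
    (h0 : ∀ i j b, 0 ≤ w i j b) : 0 ≤ offDiagProd w x :=
  prod_nonneg fun i _ => prod_nonneg fun j _ => by
    split_ifs
    exacts [zero_le_one, h0 _ _ _]

theorem sqrt_offDiagProd_mul {w w' : Fin n → Fin n → Bool → ℝ} (x : Adj n)
    (h : ∀ i j b, 0 ≤ w i j b) (h' : ∀ i j b, 0 ≤ w' i j b) :
    √(offDiagProd w x * offDiagProd w' x) =
      offDiagProd (fun i j b => √(w i j b * w' i j b)) x := by
  rw [offDiagProd, offDiagProd, ← prod_mul_distrib]
  simp_rw [← prod_mul_distrib]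
  rw [Real.sqrt_eq_iff_mul_self_eq]
  · rw [offDiagProd, ← prod_mul_distrib]
    refine prod_congr rfl fun i _ => ?_
    rw [← prod_mul_distrib]
    refine prod_congr rfl fun j _ => ?_
    split_ifs
    · simp
    · rw [Real.mul_self_sqrt (mul_nonneg (h _ _ _) (h' _ _ _))]
  · refine prod_nonneg fun i _ => prod_nonneg fun j _ => ?_
    split_ifs
    · simp
    · exact mul_nonneg (h _ _ _) (h' _ _ _)
  · exact offDiagProd_nonneg x fun i j b => Real.sqrt_nonneg _

/-- Uses 1 + e ≤ exp e on each pair. The exponent also runs over the diagonal, where the factor is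
1; hence the sign condition on `e i i`. -/
theorem sum_loopless_offDiagProd_le (w : Fin n → Fin n → Bool → ℝ) (e : Fin n → Fin n → ℝ)
    (h0 : ∀ i j b, 0 ≤ w i j b) (hd : ∀ i, 0 ≤ e i i)
    (h : ∀ i j, i ≠ j → w i j true + w i j false ≤ 1 + e i j) :
    ∑ x ∈ loopless n, offDiagProd w x ≤ Real.exp (∑ i, ∑ j, e i j) := by
  rw [sum_loopless_offDiagProd, Real.exp_sum]
  refine prod_le_prod (fun i _ => prod_nonneg fun j _ => ?_) fun i _ => ?_
  · split_ifs
    exacts [zero_le_one, add_nonneg (h0 _ _ _) (h0 _ _ _)]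
  rw [Real.exp_sum]
  refine prod_le_prod (fun j _ => ?_) fun j _ => ?_
  · split_ifs
    exacts [zero_le_one, add_nonneg (h0 _ _ _) (h0 _ _ _)]
  · split_ifs with hij
    · subst hij; exact Real.one_le_exp (hd i)
    · linarith [h i j hij, Real.add_one_le_exp (e i j)]

theorem Param.IsValid.condLik_nonneg {θ : Param Q} (hθ : θ.IsValid) (x : Adj n)
    (z : Fin n → Fin Q) : 0 ≤ condLik θ x z :=
  offDiagProd_nonneg x fun _ _ b => bern_nonneg (hθ.π_mem _ _) b

theorem Param.IsValid.labelProb_nonneg {θ : Param Q} (hθ : θ.IsValid) (z : Fin n → Fin Q) :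
    0 ≤ labelProb θ z := prod_nonneg fun _ _ => hθ.α_nonneg _

theorem Param.IsValid.α_le_one {θ : Param Q} (hθ : θ.IsValid) (q : Fin Q) : θ.α q ≤ 1 := by
  rw [← hθ.α_sum]
  exact single_le_sum (fun i _ => hθ.α_nonneg i) (mem_univ q)

theorem Param.IsValid.labelProb_le_one {θ : Param Q} (hθ : θ.IsValid) (z : Fin n → Fin Q) :
    labelProb θ z ≤ 1 := prod_le_one (fun _ _ => hθ.α_nonneg _) fun _ _ => hθ.α_le_one _

theorem Param.IsValid.sum_labelProb {θ : Param Q} (hθ : θ.IsValid) :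
    ∑ z : Fin n → Fin Q, labelProb θ z = 1 := by
  simp only [labelProb]
  rw [sum_pi_prod fun _ q => θ.α q]
  simp [hθ.α_sum]

theorem sum_condLik (θ : Param Q) (z : Fin n → Fin Q) :
    ∑ x ∈ loopless n, condLik θ x z = 1 := by
  simp_rw [condLik_eq_offDiagProd]
  rw [sum_loopless_offDiagProd]
  refine prod_eq_one fun i _ => prod_eq_one fun j _ => ?_
  simp [bern]

/-! ### A uniform bound on the conditional likelihood -/

/-- The likelihood of the labels `z`, maximized over the connectivity matrix separately for each
graph, has a total mass that is polynomial in `n`. -/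
theorem sum_condLik_le_of_isValid (hn : 0 < n) (g : Adj n → Param Q) (S : Finset (Adj n))
    (hS : S ⊆ loopless n) (hg : ∀ x ∈ S, (g x).IsValid) (z : Fin n → Fin Q) :
    ∑ x ∈ S, condLik (g x) x z ≤ ((n : ℝ) ^ 2 + 1) ^ (Q * Q) * Real.exp 1 := by
  -- Connectivity matrices are rounded to a grid of mesh 1/M. With M = n², an excess mass of 1/M per
  -- pair costs a factor e in total, and the grid has only polynomially many points.
  set M : ℕ := n ^ 2 with hM
  have hM0 : (0 : ℝ) < M := by positivity
  -- If k = ⌊πM⌋, these weights dominate both π and 1 - π, and they add up to 1 + 1/M.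
  let w : (Fin Q → Fin Q → Fin (M + 1)) → Fin n → Fin n → Bool → ℝ := fun k i j b =>
    if b then ((k (z i) (z j) : ℕ) + 1 : ℝ) / M else (M - (k (z i) (z j) : ℕ) : ℝ) / M
  have hw0 : ∀ k i j b, 0 ≤ w k i j b := by
    intro k i j b
    have : ((k (z i) (z j) : ℕ) : ℝ) ≤ M := by exact_mod_cast (Nat.lt_succ_iff.1 (k _ _).2)
    dsimp only [w]
    split_ifs
    · positivity
    · exact div_nonneg (by linarith) hM0.le
  have hsum : ∀ k, ∑ x ∈ loopless n, offDiagProd (w k) x ≤ Real.exp 1 := by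
    intro k
    refine (sum_loopless_offDiagProd_le (w k) (fun _ _ => 1 / (M : ℝ)) (hw0 k)
      (fun _ => by positivity) fun i j _ => le_of_eq ?_).trans (le_of_eq ?_)
    · simp only [w, if_true, Bool.false_eq_true, if_false]
      field_simp
      ring
    · congr 1
      simp only [sum_const, card_univ, Fintype.card_fin, nsmul_eq_mul, hM]
      push_cast
      field_simp
  have hdom : ∀ x ∈ S, condLik (g x) x z ≤ ∑ k, offDiagProd (w k) x := by
    intro x hx
    have hfl : ∀ q l, ⌊(g x).π q l * M⌋₊ < M + 1 := fun q l => by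
      rw [Nat.lt_succ_iff]
      refine Nat.floor_le_of_le ?_
      exact mul_le_of_le_one_left hM0.le ((hg x hx).π_mem q l).2
    refine le_trans ?_ (single_le_sum (f := fun k => offDiagProd (w k) x)
      (fun k _ => offDiagProd_nonneg x (hw0 k))
      (mem_univ fun q l => ⟨⌊(g x).π q l * M⌋₊, hfl q l⟩))
    rw [condLik_eq_offDiagProd]
    refine offDiagProd_le x (fun i j b => bern_nonneg ((hg x hx).π_mem _ _) b) fun i j b => ?_
    have h1 := Nat.lt_floor_add_one ((g x).π (z i) (z j) * M)
    have h2 := Nat.floor_le (mul_nonneg ((hg x hx).π_mem (z i) (z j)).1 hM0.le)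
    cases b
    · simp only [bern, w, Bool.false_eq_true, if_false]
      rw [le_div_iff₀ hM0]
      linarith
    · simp only [bern, w, if_true]
      rw [le_div_iff₀ hM0]
      linarith
  calc ∑ x ∈ S, condLik (g x) x z ≤ ∑ x ∈ S, ∑ k, offDiagProd (w k) x := sum_le_sum hdom
    _ ≤ ∑ x ∈ loopless n, ∑ k, offDiagProd (w k) x :=
        sum_le_sum_of_subset_of_nonneg hS fun x _ _ => sum_nonneg fun k _ =>
          offDiagProd_nonneg x (hw0 k)
    _ = ∑ k, ∑ x ∈ loopless n, offDiagProd (w k) x := sum_comm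
    _ ≤ ∑ _k : Fin Q → Fin Q → Fin (M + 1), Real.exp 1 := sum_le_sum fun k _ => hsum k
    _ = _ := by
        simp [hM, ← pow_mul]

/-! ### Bhattacharyya bounds -/

/-- Twice the defect from 1 is (√p - √r)² + (√(1-p) - √(1-r))². -/
theorem sqrt_mul_add_sqrt_mul_lt_one {p r : ℝ} (hp : p ∈ Set.Icc (0 : ℝ) 1)
    (hr : r ∈ Set.Icc (0 : ℝ) 1) (h : p ≠ r) : √(p * r) + √((1 - p) * (1 - r)) < 1 := by
  have hp' : 0 ≤ 1 - p := by linarith [hp.2]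
  have hr' : 0 ≤ 1 - r := by linarith [hr.2]
  rw [Real.sqrt_mul hp.1, Real.sqrt_mul hp']
  have e1 := Real.sq_sqrt hp.1
  have e2 := Real.sq_sqrt hr.1
  have e3 := Real.sq_sqrt hp'
  have e4 := Real.sq_sqrt hr'
  have hne : √p ≠ √r := fun h' => h (by rw [← e1, ← e2, h'])
  have : 0 < (√p - √r) ^ 2 := by
    have := sub_ne_zero.2 hne
    positivity
  nlinarith [sq_nonneg (√(1 - p) - √(1 - r))]

theorem sqrt_mul_add_sqrt_mul_le_one {p r : ℝ} (hp : p ∈ Set.Icc (0 : ℝ) 1)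
    (hr : r ∈ Set.Icc (0 : ℝ) 1) : √(p * r) + √((1 - p) * (1 - r)) ≤ 1 := by
  by_cases h : p = r
  · subst h
    rw [Real.sqrt_mul_self hp.1, Real.sqrt_mul_self (by linarith [hp.2])]
    linarith
  · exact (sqrt_mul_add_sqrt_mul_lt_one hp hr h).le

/-- The affinity of distinct entries of the connectivity matrix is bounded away from `1`. -/
theorem Param.IsValid.exists_affinity_gap {θ : Param Q} (hθ : θ.IsValid) :
    ∃ c : ℝ, 0 < c ∧ ∀ a b q l, θ.π a b ≠ θ.π q l →
      √(θ.π a b * θ.π q l) + √((1 - θ.π a b) * (1 - θ.π q l)) ≤ 1 - c := by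
  classical
  let f : Fin Q × Fin Q × Fin Q × Fin Q → ℝ := fun t =>
    if θ.π t.1 t.2.1 ≠ θ.π t.2.2.1 t.2.2.2 then
      1 - (√(θ.π t.1 t.2.1 * θ.π t.2.2.1 t.2.2.2) +
        √((1 - θ.π t.1 t.2.1) * (1 - θ.π t.2.2.1 t.2.2.2))) else 1
  have hf : ∀ t, 0 < f t := by
    intro t
    simp only [f]
    split_ifs with h
    · linarith [sqrt_mul_add_sqrt_mul_lt_one (hθ.π_mem _ _) (hθ.π_mem _ _) h]
    · exact one_pos
  obtain ⟨c, hc, hcf⟩ : ∃ c : ℝ, 0 < c ∧ ∀ t, c ≤ f t := by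
    rcases isEmpty_or_nonempty (Fin Q × Fin Q × Fin Q × Fin Q) with h | h
    · exact ⟨1, one_pos, fun t => h.elim t⟩
    · obtain ⟨t, ht⟩ := Finite.exists_min f
      exact ⟨f t, hf t, ht⟩
  refine ⟨c, hc, fun a b q l h => ?_⟩
  have := hcf (a, b, q, l)
  simp only [f, if_pos h] at this
  linarith

/-- The number of ordered pairs of vertices for which `z` and `y` predict different edge
probabilities. -/
noncomputable def mismatch (θ : Param Q) (z y : Fin n → Fin Q) : ℕ :=
  #{p : Fin n × Fin n | θ.π (z p.1) (z p.2) ≠ θ.π (y p.1) (y p.2)}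

/-- The parameter `g x` depends on the graph, so its weights are first dominated by the fixed
weights `bern + δ`; the sum over graphs then factorizes. Each of the two edge values costs at most
√δ, and each mismatched pair gains c. The term c n compensates for the diagonal pairs, which
`mismatch` may count although they carry no factor. -/
theorem sum_sqrt_condLik_le {θ : Param Q} (hθ : θ.IsValid) {c δ : ℝ} (hc0 : 0 ≤ c) (hδ : 0 ≤ δ)
    (hc : ∀ a b q l, θ.π a b ≠ θ.π q l →
      √(θ.π a b * θ.π q l) + √((1 - θ.π a b) * (1 - θ.π q l)) ≤ 1 - c)
    (g : Adj n → Param Q) (S : Finset (Adj n)) (hS : S ⊆ loopless n)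
    (hg : ∀ x ∈ S, (g x).IsValid) (hgδ : ∀ x ∈ S, ∀ q l, |(g x).π q l - θ.π q l| ≤ δ)
    (z y : Fin n → Fin Q) :
    ∑ x ∈ S, √(condLik (g x) x z * condLik θ x y) ≤
      Real.exp (2 * √δ * n ^ 2 - c * mismatch θ z y + c * n) := by
  classical
  have hnn : ∀ i j b, 0 ≤ bern (θ.π (z i) (z j)) b + δ := fun i j b =>
    add_nonneg (bern_nonneg (hθ.π_mem _ _) b) hδ
  set w : Fin n → Fin n → Bool → ℝ := fun i j b =>
    √((bern (θ.π (z i) (z j)) b + δ) * bern (θ.π (y i) (y j)) b) with hw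
  have hle : ∀ x ∈ S, √(condLik (g x) x z * condLik θ x y) ≤ offDiagProd w x := by
    intro x hx
    rw [hw, ← sqrt_offDiagProd_mul x hnn fun i j b => bern_nonneg (hθ.π_mem _ _) b]
    refine Real.sqrt_le_sqrt (mul_le_mul_of_nonneg_right ?_ (hθ.condLik_nonneg x y))
    refine offDiagProd_le x (fun i j b => bern_nonneg ((hg x hx).π_mem _ _) b) fun i j b => ?_
    have := abs_le.1 (hgδ x hx (z i) (z j))
    cases b <;> simp [bern] <;> linarith
  have hbd : ∀ i j b, w i j b ≤ √(bern (θ.π (z i) (z j)) b * bern (θ.π (y i) (y j)) b) + √δ := by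
    intro i j b
    have h1 := bern_nonneg (hθ.π_mem (z i) (z j)) b
    have h2 := bern_nonneg (hθ.π_mem (y i) (y j)) b
    have h3 : bern (θ.π (y i) (y j)) b ≤ 1 := by
      have := hθ.π_mem (y i) (y j)
      cases b <;> simp [bern, this.1, this.2]
    rw [hw]
    refine Real.sqrt_le_iff.2 ⟨by positivity, ?_⟩
    have e1 := Real.sq_sqrt (mul_nonneg h1 h2)
    have e2 := Real.sq_sqrt hδ
    have : 0 ≤ √(bern (θ.π (z i) (z j)) b * bern (θ.π (y i) (y j)) b) * √δ := by positivity
    nlinarith [mul_le_mul_of_nonneg_left h3 hδ]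
  calc ∑ x ∈ S, √(condLik (g x) x z * condLik θ x y) ≤ ∑ x ∈ S, offDiagProd w x :=
        sum_le_sum hle
    _ ≤ ∑ x ∈ loopless n, offDiagProd w x :=
        sum_le_sum_of_subset_of_nonneg hS fun x _ _ =>
          offDiagProd_nonneg x fun _ _ _ => Real.sqrt_nonneg _
    _ ≤ Real.exp (∑ i, ∑ j, (2 * √δ - c * (if θ.π (z i) (z j) ≠ θ.π (y i) (y j) then 1 else 0)
          + c * (if i = j then 1 else 0))) := by
        refine sum_loopless_offDiagProd_le w _ (fun _ _ _ => Real.sqrt_nonneg _)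
          (fun i => ?_) fun i j hij => ?_
        · have := Real.sqrt_nonneg δ
          simp only [if_true]
          split_ifs <;> linarith
        · have h1 := hbd i j true
          have h2 := hbd i j false
          simp only [bern, if_true, Bool.false_eq_true, if_false] at h1 h2
          rw [if_neg hij]
          split_ifs with h
          · linarith [hc _ _ _ _ h]
          · linarith [sqrt_mul_add_sqrt_mul_le_one (hθ.π_mem (z i) (z j)) (hθ.π_mem (y i) (y j))]
    _ = _ := by
        congr 1
        have : (mismatch θ z y : ℝ) =
            ∑ i, ∑ j, if θ.π (z i) (z j) ≠ θ.π (y i) (y j) then (1 : ℝ) else 0 := by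
          rw [mismatch, card_filter, Nat.cast_sum, Fintype.sum_prod_type]
          push_cast
          rfl
        simp only [sum_add_distrib, sum_sub_distrib, ← mul_sum, ← this]
        simp
        ring

/-! ### Label vectors close to the true labels -/

open Classical in
/-- The label vectors that agree with `y` up to a symmetry of `π` and at most `r` errors. -/
noncomputable def near (π : Fin Q → Fin Q → ℝ) (r : ℝ) (y : Fin n → Fin Q) :
    Finset (Fin n → Fin Q) :=
  {z | ∃ σ ∈ symmetries π, (hammingDist z (σ ∘ y) : ℝ) ≤ r}

theorem sum_exp_hammingDist_le (s : ℝ) (v : Fin n → Fin Q) :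
    ∑ z : Fin n → Fin Q, Real.exp (-s * hammingDist z v) ≤ Real.exp (n * (Q * Real.exp (-s))) := by
  have h : ∀ z : Fin n → Fin Q, Real.exp (-s * hammingDist z v) =
      ∏ i, if z i = v i then 1 else Real.exp (-s) := by
    intro z
    rw [prod_ite, prod_const, prod_const, one_pow, one_mul, ← Real.exp_nat_mul, hammingDist,
      mul_comm]
  simp_rw [h]
  rw [sum_pi_prod fun i k => if k = v i then 1 else Real.exp (-s)]
  calc ∏ i : Fin n, ∑ k : Fin Q, (if k = v i then 1 else Real.exp (-s))
      ≤ ∏ _i : Fin n, Real.exp (Q * Real.exp (-s)) := by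
        refine prod_le_prod (fun i _ => sum_nonneg fun k _ => ?_) fun i _ => ?_
        · split_ifs <;> positivity
        · have : ∑ k : Fin Q, (if k = v i then 1 else Real.exp (-s)) ≤
              ∑ k : Fin Q, ((if k = v i then 1 else 0) + Real.exp (-s)) := by
            refine sum_le_sum fun k _ => ?_
            split_ifs
            · linarith [Real.exp_pos (-s)]
            · simp
          refine this.trans ?_
          rw [sum_add_distrib]
          simp only [sum_ite_eq', mem_univ, if_true, sum_const, card_univ, Fintype.card_fin,
            nsmul_eq_mul]
          linarith [Real.add_one_le_exp ((Q : ℝ) * Real.exp (-s))]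
    _ = _ := by rw [prod_const, card_univ, Fintype.card_fin, ← Real.exp_nat_mul]

/-- An exponential Markov bound for the counting measure, summed over all permutations. Taking s
large and then η small makes the exponential rate arbitrarily small. -/
theorem card_near_le (π : Fin Q → Fin Q → ℝ) {s η : ℝ} (hs : 0 ≤ s) (y : Fin n → Fin Q) :
    (#(near π (η * n) y) : ℝ) ≤ Q.factorial * Real.exp (n * (s * η + Q * Real.exp (-s))) := by
  classical
  have h1 : ∀ z ∈ near π (η * n) y,
      (1 : ℝ) ≤ ∑ σ : Equiv.Perm (Fin Q), Real.exp (s * (η * n) + -s * hammingDist z (σ ∘ y)) := by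
    intro z hz
    obtain ⟨σ, -, hσ⟩ := (mem_filter.1 hz).2
    refine le_trans ?_ (single_le_sum (fun σ _ => (Real.exp_pos _).le) (mem_univ σ))
    exact Real.one_le_exp (by nlinarith)
  calc (#(near π (η * n) y) : ℝ) = ∑ z ∈ near π (η * n) y, (1 : ℝ) := by simp
    _ ≤ ∑ z ∈ near π (η * n) y, ∑ σ : Equiv.Perm (Fin Q),
          Real.exp (s * (η * n) + -s * hammingDist z (σ ∘ y)) := sum_le_sum h1
    _ ≤ ∑ z, ∑ σ : Equiv.Perm (Fin Q),
          Real.exp (s * (η * n) + -s * hammingDist z (σ ∘ y)) :=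
        sum_le_sum_of_subset_of_nonneg (subset_univ _) fun z _ _ =>
          sum_nonneg fun σ _ => (Real.exp_pos _).le
    _ = ∑ σ : Equiv.Perm (Fin Q), Real.exp (s * (η * n)) *
          ∑ z : Fin n → Fin Q, Real.exp (-s * hammingDist z (σ ∘ y)) := by
        rw [sum_comm]
        simp_rw [mul_sum, Real.exp_add]
    _ ≤ ∑ _σ : Equiv.Perm (Fin Q), Real.exp (s * (η * n)) *
          Real.exp (n * (Q * Real.exp (-s))) :=
        sum_le_sum fun σ _ => mul_le_mul_of_nonneg_left (sum_exp_hammingDist_le s _)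
          (Real.exp_pos _).le
    _ = _ := by
        rw [sum_const, card_univ, Fintype.card_perm, Fintype.card_fin, nsmul_eq_mul,
          ← Real.exp_add]
        congr 2
        ring

/-- A label vector that is not close to `y` up to a symmetry mispredicts a positive proportion of
the edge probabilities. -/
theorem le_mismatch_of_notMem_near {θ : Param Q} (hA1 : θ.A1) {κ η : ℝ} (hκ : 0 ≤ κ)
    {y z : Fin n → Fin Q} (hκη : κ * Q ^ 2 ≤ η) (hy : ∀ q, κ * Q * n ≤ #{i | y i = q})
    (hQ : 0 < Q) (hz : z ∉ near θ.π (η * n) y) : κ ^ 2 * n ^ 2 ≤ mismatch θ z y := by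
  classical
  let C : Fin Q → Fin Q → Finset (Fin n) := fun q a => {i | y i = q ∧ z i = a}
  by_contra! hlt
  -- Otherwise all pairs in the product of these two large cells are mismatched, which already gives
  -- κ²n² of them.
  have hcomp : ∀ q a l b, κ * n ≤ #(C q a) → κ * n ≤ #(C l b) → θ.π a b = θ.π q l := by
    intro q a l b h1 h2
    by_contra hne
    have hsub : C q a ×ˢ C l b ⊆
        ({p : Fin n × Fin n | θ.π (z p.1) (z p.2) ≠ θ.π (y p.1) (y p.2)} : Finset _) := by
      rintro ⟨i, j⟩ hij
      simp only [mem_product, C, mem_filter, mem_univ, true_and] at hij ⊢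
      rw [hij.1.1, hij.1.2, hij.2.1, hij.2.2]
      exact hne
    have hcard := card_le_card hsub
    rw [card_product] at hcard
    have hcard' : (#(C q a) : ℝ) * #(C l b) ≤ mismatch θ z y := by
      rw [mismatch]
      exact_mod_cast hcard
    have := mul_le_mul h1 h2 (by positivity) (by positivity)
    nlinarith
  -- Pigeonhole: a class of at least κQn vertices is split into Q cells.
  have hex : ∀ q, ∃ a, κ * n ≤ #(C q a) := by
    intro q
    by_contra! h
    have h1 : #{i | y i = q} = ∑ a, #(C q a) := by
      rw [card_eq_sum_card_fiberwise (f := z) (t := univ) (fun _ _ => mem_coe.2 (mem_univ _))]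
      refine sum_congr rfl fun a _ => ?_
      simp only [C, filter_filter]
    have h2 : (#{i | y i = q} : ℝ) < ∑ _a : Fin Q, κ * n := by
      rw [h1]
      push_cast
      exact sum_lt_sum_of_nonempty ⟨⟨0, hQ⟩, mem_univ _⟩ fun a _ => h a
    have h3 := hy q
    simp at h2
    nlinarith
  -- Two classes with the same image under a choice of large cells would have equal connectivity
  -- profiles, against (A1).
  have hinj : ∀ f : Fin Q → Fin Q, (∀ q, κ * n ≤ #(C q (f q))) → Function.Injective f := by
    intro f hf q q' hqq
    by_contra hne
    obtain ⟨l, hl | hl⟩ := hA1 q q' hne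
    · rw [← hcomp q (f q) l (f l) (hf q) (hf l), ← hcomp q' (f q') l (f l) (hf q') (hf l), hqq] at hl
      exact hl rfl
    · rw [← hcomp l (f l) q (f q) (hf l) (hf q), ← hcomp l (f l) q' (f q') (hf l) (hf q'), hqq] at hl
      exact hl rfl
  choose f hf using hex
  have hfinj := hinj f hf
  -- A second large cell of class q has a label a = f p with p ≠ q; changing f to a at q would give
  -- a non-injective choice of large cells.
  have huniq : ∀ q a, κ * n ≤ #(C q a) → a = f q := by
    intro q a ha
    by_contra hne
    have hg : ∀ p, κ * n ≤ #(C p (Function.update f q a p)) := by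
      intro p
      by_cases hp : p = q
      · subst hp; simpa using ha
      · simpa [hp] using hf p
    obtain ⟨p, hp⟩ := (Finite.injective_iff_surjective.1 hfinj) a
    have hpq : p ≠ q := fun h => hne (by rw [← hp, h])
    refine hpq (hinj _ hg ?_)
    simp [hpq, hp]
  let σ : Equiv.Perm (Fin Q) := Equiv.ofBijective f (Finite.injective_iff_bijective.1 hfinj)
  have hσ : σ ∈ symmetries θ.π := fun q l => hcomp q (f q) l (f l) (hf q) (hf l)
  refine hz (mem_filter.2 ⟨mem_univ _, σ, hσ, ?_⟩)
  -- All errors lie in small cells: there are at most Q² of them, each with fewer than κn vertices.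
  have hsub : ({i | z i ≠ (σ ∘ y) i} : Finset (Fin n)) ⊆
      univ.biUnion fun p : Fin Q × Fin Q => if p.2 = f p.1 then ∅ else C p.1 p.2 := by
    intro i hi
    have hi' : z i ≠ f (y i) := (mem_filter.1 hi).2
    refine mem_biUnion.2 ⟨(y i, z i), mem_univ _, ?_⟩
    rw [if_neg hi']
    simp [C]
  have hcard : hammingDist z (σ ∘ y) ≤
      ∑ p : Fin Q × Fin Q, #(if p.2 = f p.1 then ∅ else C p.1 p.2) :=
    (card_le_card hsub).trans card_biUnion_le
  calc (hammingDist z (σ ∘ y) : ℝ)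
      ≤ ∑ p : Fin Q × Fin Q, (#(if p.2 = f p.1 then ∅ else C p.1 p.2) : ℝ) := by
        exact_mod_cast hcard
    _ ≤ ∑ _p : Fin Q × Fin Q, κ * n := by
        refine sum_le_sum fun p _ => ?_
        split_ifs with h
        · simp; positivity
        · by_contra! h'
          exact h (huniq _ _ h'.le)
    _ = κ * Q ^ 2 * n := by
        simp
        ring
    _ ≤ η * n := mul_le_mul_of_nonneg_right hκη (Nat.cast_nonneg n)

/-! ### Probabilities of events that depend on the labels and on the graph -/

open Classical in
/-- The probability that the labels and the graph on `n` vertices satisfy `E`. -/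
noncomputable def prob (θ : Param Q) (E : (Fin n → Fin Q) → Adj n → Prop) : ℝ :=
  ∑ y, ∑ x ∈ loopless n with E y x, labelProb θ y * condLik θ x y

/-- Covering the event by the finitely many atoms of labels and graph reduces all probabilities to
finite sums. -/
theorem IsSBM.measure_le {Ω : Type*} [MeasurableSpace Ω] {μ : Measure Ω} {θ : Param Q}
    {Z : ℕ → Ω → Fin Q} {X : ℕ → ℕ → Ω → Bool} (hX : IsSBM μ θ Z X) (hθ : θ.IsValid)
    (E : (Fin n → Fin Q) → Adj n → Prop) :
    μ {ω | E (fun i => Z i ω) (restrict X n ω)} ≤ ENNReal.ofReal (prob θ E) := by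
  classical
  have hsub : {ω | E (fun i => Z i ω) (restrict X n ω)} ⊆
      ⋃ y ∈ (univ : Finset (Fin n → Fin Q)), ⋃ x ∈ {x ∈ loopless n | E y x},
        {ω | (∀ i : Fin n, Z i ω = y i) ∧ restrict X n ω = x} := by
    intro ω hω
    simp only [Set.mem_iUnion]
    refine ⟨fun i => Z i ω, mem_univ _, restrict X n ω, mem_filter.2 ⟨?_, hω⟩, fun _ => rfl, rfl⟩
    exact mem_filter.2 ⟨mem_univ _, fun i => hX.no_loop _ _⟩
  have hnn : ∀ (y : Fin n → Fin Q) x, 0 ≤ labelProb θ y * condLik θ x y := fun y x =>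
    mul_nonneg (hθ.labelProb_nonneg y) (hθ.condLik_nonneg x y)
  calc μ {ω | E (fun i => Z i ω) (restrict X n ω)} ≤ _ := measure_mono hsub
    _ ≤ ∑ y, μ (⋃ x ∈ {x ∈ loopless n | E y x},
          {ω | (∀ i : Fin n, Z i ω = y i) ∧ restrict X n ω = x}) :=
        measure_biUnion_finset_le _ _
    _ ≤ ∑ y, ∑ x ∈ {x ∈ loopless n | E y x},
          μ {ω | (∀ i : Fin n, Z i ω = y i) ∧ restrict X n ω = x} :=
        sum_le_sum fun y _ => measure_biUnion_finset_le _ _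
    _ = ∑ y, ∑ x ∈ {x ∈ loopless n | E y x}, ENNReal.ofReal (labelProb θ y * condLik θ x y) := by
        refine sum_congr rfl fun y _ => sum_congr rfl fun x hx => ?_
        exact hX.law n y x (mem_filter.1 (mem_filter.1 hx).1).2
    _ = ENNReal.ofReal (prob θ E) := by
        rw [prob, ENNReal.ofReal_sum_of_nonneg fun y _ => sum_nonneg fun x _ => hnn y x]
        refine sum_congr rfl fun y _ => ?_
        rw [ENNReal.ofReal_sum_of_nonneg fun x _ => hnn y x]

/-- If, for each label vector, the joint weight restricted to `E` is at most `labelProb` times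
`B`, then `B` bounds the probability of `E`. -/
theorem prob_le_of_forall {θ : Param Q} (hθ : θ.IsValid) {E : (Fin n → Fin Q) → Adj n → Prop}
    {B : ℝ} (h : ∀ y, ∀ S ⊆ loopless n, (∀ x ∈ S, E y x) → ∑ x ∈ S, condLik θ x y ≤ B) :
    prob θ E ≤ B := by
  classical
  calc prob θ E ≤ ∑ y : Fin n → Fin Q, labelProb θ y * B := by
        refine sum_le_sum fun y _ => ?_
        rw [← mul_sum]
        exact mul_le_mul_of_nonneg_left
          (h y _ (filter_subset _ _) fun x hx => (mem_filter.1 hx).2) (hθ.labelProb_nonneg y)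
    _ = B := by rw [← sum_mul, hθ.sum_labelProb, one_mul]

/-! ### Concentration of the class sizes -/

/-- Chernoff bound with exponential parameter κ/2. The condition κ ≤ 2 keeps the exponents u in [-1,
1], where exp u ≤ 1 + u + u²; the rate is κ²/2 - κ²/4. -/
theorem sum_labelProb_of_le_sum {θ : Param Q} (hθ : θ.IsValid) {κ : ℝ} (hκ0 : 0 ≤ κ) (hκ : κ ≤ 2)
    (g : Fin Q → ℝ) (hg : ∀ q, |g q| ≤ 1) (hmean : ∑ q, θ.α q * g q = 0) :
    (∑ y : Fin n → Fin Q, if κ * n ≤ ∑ i, g (y i) then labelProb θ y else 0) ≤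
      Real.exp (-(κ ^ 2 / 4) * n) := by
  have h1 : ∀ y : Fin n → Fin Q, (if κ * n ≤ ∑ i, g (y i) then labelProb θ y else 0) ≤
      Real.exp (-(κ / 2 * (κ * n))) * ∏ i, θ.α (y i) * Real.exp (κ / 2 * g (y i)) := by
    intro y
    rw [prod_mul_distrib, ← Real.exp_sum, ← mul_sum]
    have hl := hθ.labelProb_nonneg y
    rw [show ∏ i, θ.α (y i) = labelProb θ y from rfl, mul_left_comm, ← Real.exp_add]
    split_ifs with h
    · exact le_mul_of_one_le_right hl (Real.one_le_exp (by nlinarith))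
    · positivity
  have h2 : ∑ q, θ.α q * Real.exp (κ / 2 * g q) ≤ Real.exp ((κ / 2) ^ 2) := by
    calc ∑ q, θ.α q * Real.exp (κ / 2 * g q)
        ≤ ∑ q, (θ.α q * (1 + (κ / 2) ^ 2) + κ / 2 * (θ.α q * g q)) := by
          refine sum_le_sum fun q _ => ?_
          have h3 : |κ / 2 * g q| ≤ κ / 2 := by
            rw [abs_mul, abs_of_nonneg (by linarith)]
            exact mul_le_of_le_one_right (by linarith) (hg q)
          have h4 := (abs_le.1 (Real.abs_exp_sub_one_sub_id_le (h3.trans (by linarith)))).2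
          have h5 : (κ / 2 * g q) ^ 2 ≤ (κ / 2) ^ 2 := by
            rw [← sq_abs]
            exact pow_le_pow_left₀ (abs_nonneg _) h3 2
          have := mul_le_mul_of_nonneg_left
            (show Real.exp (κ / 2 * g q) ≤ 1 + (κ / 2) ^ 2 + κ / 2 * g q by linarith)
            (hθ.α_nonneg q)
          linarith
      _ = 1 + (κ / 2) ^ 2 := by
          rw [sum_add_distrib, ← mul_sum, hmean, ← sum_mul, hθ.α_sum]
          ring
      _ ≤ _ := by linarith [Real.add_one_le_exp ((κ / 2) ^ 2)]
  calc _ ≤ _ := sum_le_sum fun y _ => h1 y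
    _ = Real.exp (-(κ / 2 * (κ * n))) * (∑ q, θ.α q * Real.exp (κ / 2 * g q)) ^ n := by
        rw [← mul_sum, sum_pi_prod fun _ q => θ.α q * Real.exp (κ / 2 * g q)]
        simp
    _ ≤ Real.exp (-(κ / 2 * (κ * n))) * Real.exp ((κ / 2) ^ 2) ^ n := by
        refine mul_le_mul_of_nonneg_left (pow_le_pow_left₀ (sum_nonneg fun q _ => ?_) h2 n)
          (Real.exp_pos _).le
        exact mul_nonneg (hθ.α_nonneg q) (Real.exp_pos _).le
    _ = _ := by
        rw [← Real.exp_nat_mul, ← Real.exp_add]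
        congr 1
        ring

theorem prob_class_size_le {θ : Param Q} (hθ : θ.IsValid) {κ : ℝ} (hκ0 : 0 ≤ κ) (hκ : κ ≤ 2) :
    prob θ (fun (y : Fin n → Fin Q) _ => ∃ q, κ * n < |(#{i | y i = q} : ℝ) - n * θ.α q|) ≤
      2 * Q * Real.exp (-(κ ^ 2 / 4) * n) := by
  classical
  let g : Fin Q → Fin Q → ℝ := fun q a => (if a = q then 1 else 0) - θ.α q
  have hgsum : ∀ q (y : Fin n → Fin Q), ∑ i, g q (y i) = (#{i | y i = q} : ℝ) - n * θ.α q := by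
    intro q y
    simp [g]
  have hg1 : ∀ q a, |g q a| ≤ 1 := by
    intro q a
    have := hθ.α_nonneg q
    have := hθ.α_le_one q
    simp only [g]
    rw [abs_le]
    split_ifs <;> constructor <;> linarith
  have hg0 : ∀ q, ∑ a, θ.α a * g q a = 0 := by
    intro q
    simp only [g, mul_sub, sum_sub_distrib, ← sum_mul, hθ.α_sum]
    simp
  have key : ∀ y : Fin n → Fin Q,
      (∑ x ∈ loopless n with ∃ q, κ * n < |(#{i | y i = q} : ℝ) - n * θ.α q|,
        labelProb θ y * condLik θ x y) ≤
      ∑ q, ((if κ * n ≤ ∑ i, g q (y i) then labelProb θ y else 0) +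
        (if κ * n ≤ ∑ i, -g q (y i) then labelProb θ y else 0)) := by
    intro y
    have hl := hθ.labelProb_nonneg y
    have hnn : ∀ q, 0 ≤ ((if κ * n ≤ ∑ i, g q (y i) then labelProb θ y else 0) +
        (if κ * n ≤ ∑ i, -g q (y i) then labelProb θ y else 0)) := by
      intro q
      split_ifs <;> positivity
    by_cases h : ∃ q, κ * n < |(#{i | y i = q} : ℝ) - n * θ.α q|
    · obtain ⟨q, hq⟩ := h
      refine le_trans ?_ (single_le_sum (fun q _ => hnn q) (mem_univ q))
      rw [filter_true_of_mem fun _ _ => ⟨q, hq⟩, ← mul_sum, sum_condLik, mul_one]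
      rw [sum_neg_distrib, hgsum]
      rcases lt_abs.1 hq with h | h
      · rw [if_pos h.le]
        split_ifs <;> linarith
      · rw [if_pos h.le (c := κ * n ≤ -_)]
        split_ifs <;> linarith
    · rw [filter_false_of_mem fun _ _ => h, sum_empty]
      exact sum_nonneg fun q _ => hnn q
  calc prob θ _ ≤ ∑ y : Fin n → Fin Q,
        ∑ q, ((if κ * n ≤ ∑ i, g q (y i) then labelProb θ y else 0) +
        (if κ * n ≤ ∑ i, -g q (y i) then labelProb θ y else 0)) := by
        rw [prob]
        refine sum_le_sum fun y _ => le_trans (le_of_eq (sum_congr ?_ fun _ _ => rfl)) (key y)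
        ext x
        simp only [mem_filter]
    _ ≤ ∑ _q : Fin Q, (Real.exp (-(κ ^ 2 / 4) * n) + Real.exp (-(κ ^ 2 / 4) * n)) := by
        rw [sum_comm]
        refine sum_le_sum fun q _ => ?_
        rw [sum_add_distrib]
        refine add_le_add (sum_labelProb_of_le_sum hθ hκ0 hκ (g q) (hg1 q) (hg0 q))
          (sum_labelProb_of_le_sum hθ hκ0 hκ (fun a => -g q a) (fun a => ?_) ?_)
        · rw [abs_neg]; exact hg1 q a
        · simp only [mul_neg, sum_neg_distrib, hg0 q, neg_zero]
    _ = _ := by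
        simp
        ring

/-! ### Concentration of the posterior weights around the true labels -/

/-- First-moment bound: on the event the true conditional likelihood is at most exp(-2τn) times the
near sum, whose total over graphs is at most Q! exp(τn) times a polynomial. Graphs with `condLik θ x
y = 0` have no mass and are included so that they can be discarded later. -/
theorem prob_near_le {θ : Param Q} (hθ : θ.IsValid) (hn : 0 < n) (g : Adj n → Param Q)
    {s η τ : ℝ} (hs : 0 ≤ s) (hτ : s * η + Q * Real.exp (-s) ≤ τ) :
    prob θ (fun (y : Fin n → Fin Q) x => (g x).IsValid ∧ (condLik θ x y = 0 ∨
      Real.exp (2 * τ * n) * condLik θ x y < ∑ z ∈ near θ.π (η * n) y, condLik (g x) x z)) ≤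
    Q.factorial * ((n : ℝ) ^ 2 + 1) ^ (Q * Q) * Real.exp 1 * Real.exp (-τ * n) := by
  refine prob_le_of_forall hθ fun y S hS hE => ?_
  have h1 : ∀ x ∈ S, condLik θ x y ≤
      Real.exp (-(2 * τ * n)) * ∑ z ∈ near θ.π (η * n) y, condLik (g x) x z := by
    intro x hx
    have h0 : 0 ≤ ∑ z ∈ near θ.π (η * n) y, condLik (g x) x z :=
      sum_nonneg fun z _ => (hE x hx).1.condLik_nonneg x z
    rcases (hE x hx).2 with h | h
    · rw [h]; positivity
    · rw [Real.exp_neg, ← div_eq_inv_mul, le_div_iff₀ (Real.exp_pos _), mul_comm]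
      exact h.le
  calc ∑ x ∈ S, condLik θ x y ≤ _ := sum_le_sum h1
    _ = Real.exp (-(2 * τ * n)) * ∑ z ∈ near θ.π (η * n) y, ∑ x ∈ S, condLik (g x) x z := by
        rw [← mul_sum, sum_comm]
    _ ≤ Real.exp (-(2 * τ * n)) * ((Q.factorial * Real.exp (n * τ)) *
          (((n : ℝ) ^ 2 + 1) ^ (Q * Q) * Real.exp 1)) := by
        refine mul_le_mul_of_nonneg_left ?_ (Real.exp_pos _).le
        refine (sum_le_card_nsmul _ _ _ fun z _ =>
          sum_condLik_le_of_isValid hn g S hS (fun x hx => (hE x hx).1) z).trans ?_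
        rw [nsmul_eq_mul]
        refine mul_le_mul_of_nonneg_right ((card_near_le θ.π hs y).trans ?_) (by positivity)
        gcongr
    _ = _ := by
        have : Real.exp (-τ * n) = Real.exp (-(2 * τ * n)) * Real.exp (n * τ) := by
          rw [← Real.exp_add]
          congr 1
          ring
        rw [this]
        ring

theorem sqrt_sum_le_sum_sqrt {ι : Type*} (s : Finset ι) (f : ι → ℝ) (hf : ∀ i ∈ s, 0 ≤ f i) :
    √(∑ i ∈ s, f i) ≤ ∑ i ∈ s, √(f i) := by
  rw [Real.sqrt_le_iff]
  refine ⟨sum_nonneg fun i _ => Real.sqrt_nonneg _, ?_⟩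
  calc ∑ i ∈ s, f i = ∑ i ∈ s, √(f i) ^ 2 := sum_congr rfl fun i hi => (Real.sq_sqrt (hf i hi)).symm
    _ ≤ _ := sum_sq_le_sq_sum_of_nonneg fun i _ => Real.sqrt_nonneg _

/-- With L the true conditional likelihood and L_z the estimated ones, ρL < ∑ L_z and ρ ≤ 1 give
(ρL)² ≤ ∑ L_z L, hence ρL ≤ ∑ √(L_z L). The affinity bound then applies to each of the at most Qⁿ
far vectors. -/
theorem prob_far_le {θ : Param Q} (hθ : θ.IsValid) (hA1 : θ.A1) (hQ : 0 < Q)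
    (g : Adj n → Param Q) {c δ ρ κ η : ℝ} (hc0 : 0 ≤ c) (hδ : 0 ≤ δ) (hρ0 : 0 < ρ) (hρ : ρ ≤ 1)
    (hκ : 0 ≤ κ) (hκη : κ * Q ^ 2 ≤ η)
    (hc : ∀ a b q l, θ.π a b ≠ θ.π q l →
      √(θ.π a b * θ.π q l) + √((1 - θ.π a b) * (1 - θ.π q l)) ≤ 1 - c) :
    prob θ (fun (y : Fin n → Fin Q) x => (g x).IsValid ∧ (∀ q l, |(g x).π q l - θ.π q l| ≤ δ) ∧
      (∀ q, κ * Q * n ≤ #{i | y i = q}) ∧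
      ρ * condLik θ x y < ∑ z ∈ (near θ.π (η * n) y)ᶜ, condLik (g x) x z) ≤
    ρ⁻¹ * Q ^ n * Real.exp (2 * √δ * n ^ 2 - c * (κ ^ 2 * n ^ 2) + c * n) := by
  refine prob_le_of_forall hθ fun y S hS hE => ?_
  -- The class-size condition does not involve the graph, so any single element of S provides it.
  rcases S.eq_empty_or_nonempty with rfl | ⟨x₀, hx₀⟩
  · rw [sum_empty]; positivity
  have hy := (hE x₀ hx₀).2.2.1
  have h1 : ∀ x ∈ S, condLik θ x y ≤
      ρ⁻¹ * ∑ z ∈ (near θ.π (η * n) y)ᶜ, √(condLik (g x) x z * condLik θ x y) := by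
    intro x hx
    have hcl := hθ.condLik_nonneg x y
    have h0 : ∀ z, 0 ≤ condLik (g x) x z := fun z => (hE x hx).1.condLik_nonneg x z
    have hlt := (hE x hx).2.2.2
    rw [← div_eq_inv_mul, le_div_iff₀ hρ0]
    refine le_trans ?_ (sqrt_sum_le_sum_sqrt _ _ fun z _ => mul_nonneg (h0 z) hcl)
    rw [← sum_mul]
    refine Real.le_sqrt_of_sq_le ?_
    have h2 : ρ * (ρ * condLik θ x y) ≤ 1 * (ρ * condLik θ x y) :=
      mul_le_mul_of_nonneg_right hρ (by positivity)
    nlinarith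
  calc ∑ x ∈ S, condLik θ x y ≤ _ := sum_le_sum h1
    _ = ρ⁻¹ * ∑ z ∈ (near θ.π (η * n) y)ᶜ, ∑ x ∈ S, √(condLik (g x) x z * condLik θ x y) := by
        rw [← mul_sum, sum_comm]
    _ ≤ ρ⁻¹ * ∑ z ∈ (near θ.π (η * n) y)ᶜ,
          Real.exp (2 * √δ * n ^ 2 - c * (κ ^ 2 * n ^ 2) + c * n) := by
        refine mul_le_mul_of_nonneg_left (sum_le_sum fun z hz => ?_) (by positivity)
        refine (sum_sqrt_condLik_le hθ hc0 hδ hc g S hS (fun x hx => (hE x hx).1)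
          (fun x hx => (hE x hx).2.1) z y).trans (Real.exp_le_exp.2 ?_)
        have := mul_le_mul_of_nonneg_left
          (le_mismatch_of_notMem_near hA1 hκ hκη hy hQ (mem_compl.1 hz)) hc0
        linarith
    _ ≤ ρ⁻¹ * ∑ _z : Fin n → Fin Q,
          Real.exp (2 * √δ * n ^ 2 - c * (κ ^ 2 * n ^ 2) + c * n) := by
        refine mul_le_mul_of_nonneg_left ?_ (by positivity)
        exact sum_le_sum_of_subset_of_nonneg (subset_univ _) fun _ _ _ => (Real.exp_pos _).le
    _ = _ := by
        simp
        ring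

/-! ### From the likelihood comparison to the group proportions -/

/-- The squared Hellinger distance ∑ (√a - √b)² equals 2 - 2 ∑ √(ab), and a - b = (√a + √b)(√a - √b)
with the first factor at most 2. -/
theorem abs_sub_le_of_affinity {ι : Type*} [Fintype ι] {a b : ι → ℝ} (ha : ∀ i, 0 ≤ a i)
    (hb : ∀ i, 0 ≤ b i) (ha1 : ∑ i, a i = 1) (hb1 : ∑ i, b i = 1) {ρ : ℝ}
    (h : 1 - ρ ≤ ∑ i, √(a i * b i)) (i : ι) : |a i - b i| ≤ 2 * √(2 * ρ) := by
  have hsq : ∑ i, (√(a i) - √(b i)) ^ 2 ≤ 2 * ρ := by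
    have : ∀ i, (√(a i) - √(b i)) ^ 2 = a i + b i - 2 * √(a i * b i) := by
      intro i
      rw [sub_sq, Real.sq_sqrt (ha i), Real.sq_sqrt (hb i), Real.sqrt_mul (ha i)]
      ring
    simp_rw [this]
    rw [sum_sub_distrib, sum_add_distrib, ha1, hb1, ← mul_sum]
    linarith
  have hi : |√(a i) - √(b i)| ≤ √(2 * ρ) := by
    refine Real.abs_le_sqrt (le_trans ?_ hsq)
    exact single_le_sum (f := fun i => (√(a i) - √(b i)) ^ 2) (fun i _ => sq_nonneg _) (mem_univ i)
  have ha' : √(a i) ≤ 1 := Real.sqrt_le_one.2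
    (by rw [← ha1]; exact single_le_sum (fun i _ => ha i) (mem_univ i))
  have hb' : √(b i) ≤ 1 := Real.sqrt_le_one.2
    (by rw [← hb1]; exact single_le_sum (fun i _ => hb i) (mem_univ i))
  have : a i - b i = (√(a i) + √(b i)) * (√(a i) - √(b i)) := by
    have e1 := Real.sq_sqrt (ha i)
    have e2 := Real.sq_sqrt (hb i)
    linear_combination e2 - e1
  rw [this, abs_mul, abs_of_nonneg (by positivity)]
  exact mul_le_mul (by linarith) hi (abs_nonneg _) (by norm_num)

/-- If label vectors close to `y` carry most of the likelihood, a parameter whose likelihood is at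
least that of the true one gives some of them a large probability. -/
theorem exists_near_of_lik_le {θ θ' : Param Q} (hθ : θ.IsValid) (hθ' : θ'.IsValid) {γ r τ : ℝ}
    (hγ : 0 < γ) (hγα : ∀ q, γ ≤ θ.α q) (hn : 0 < n) (hτn : Real.exp (-τ * n) < 1 / 2)
    {x : Adj n} {y : Fin n → Fin Q} (hc : condLik θ x y ≠ 0)
    (hnear : ∑ z ∈ near θ.π r y, condLik θ' x z ≤ Real.exp (2 * τ * n) * condLik θ x y)
    (hfar : ∑ z ∈ (near θ.π r y)ᶜ, condLik θ' x z ≤ (γ / 2) ^ n * condLik θ x y)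
    (hL : ∑ z, condLik θ x z * labelProb θ z ≤ ∑ z, condLik θ' x z * labelProb θ' z) :
    ∃ z ∈ near θ.π r y, Real.exp (-(3 * τ * n)) * labelProb θ y < labelProb θ' z := by
  by_contra! h
  have hcpos : 0 < condLik θ x y := lt_of_le_of_ne (hθ.condLik_nonneg x y) hc.symm
  have hA : γ ^ n ≤ labelProb θ y := by
    calc γ ^ n = ∏ _i : Fin n, γ := by simp
      _ ≤ _ := prod_le_prod (fun _ _ => hγ.le) fun i _ => hγα _
  have hApos : 0 < labelProb θ y := lt_of_lt_of_le (pow_pos hγ n) hA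
  have h1 : condLik θ x y * labelProb θ y ≤ ∑ z, condLik θ x z * labelProb θ z :=
    single_le_sum (f := fun z => condLik θ x z * labelProb θ z)
      (fun z _ => mul_nonneg (hθ.condLik_nonneg x z) (hθ.labelProb_nonneg z)) (mem_univ y)
  -- The near part is less than half of the term of `y` in the true likelihood, since exp(-τn) <
  -- 1/2.
  have h2 : ∑ z ∈ near θ.π r y, condLik θ' x z * labelProb θ' z ≤
      Real.exp (-τ * n) * (condLik θ x y * labelProb θ y) := by
    calc ∑ z ∈ near θ.π r y, condLik θ' x z * labelProb θ' z
        ≤ ∑ z ∈ near θ.π r y, condLik θ' x z * (Real.exp (-(3 * τ * n)) * labelProb θ y) :=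
          sum_le_sum fun z hz => mul_le_mul_of_nonneg_left (h z hz) (hθ'.condLik_nonneg x z)
      _ ≤ Real.exp (2 * τ * n) * condLik θ x y * (Real.exp (-(3 * τ * n)) * labelProb θ y) := by
          rw [← sum_mul]
          exact mul_le_mul_of_nonneg_right hnear (by positivity)
      _ = _ := by
          have : Real.exp (-τ * n) = Real.exp (2 * τ * n) * Real.exp (-(3 * τ * n)) := by
            rw [← Real.exp_add]
            congr 1
            ring
          rw [this]
          ring
  -- The far part is at most half of that same term, since (γ/2)ⁿ ≤ γⁿ/2 and γⁿ bounds the label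
  -- probability of `y` from below. Together the two parts contradict `hL`.
  have h3 : ∑ z ∈ (near θ.π r y)ᶜ, condLik θ' x z * labelProb θ' z ≤
      1 / 2 * (condLik θ x y * labelProb θ y) := by
    calc ∑ z ∈ (near θ.π r y)ᶜ, condLik θ' x z * labelProb θ' z
        ≤ ∑ z ∈ (near θ.π r y)ᶜ, condLik θ' x z :=
          sum_le_sum fun z _ => mul_le_of_le_one_right (hθ'.condLik_nonneg x z)
            (hθ'.labelProb_le_one z)
      _ ≤ (γ / 2) ^ n * condLik θ x y := hfar
      _ ≤ 1 / 2 * labelProb θ y * condLik θ x y := by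
          refine mul_le_mul_of_nonneg_right ?_ hcpos.le
          rw [div_eq_mul_one_div, mul_pow, mul_comm]
          refine mul_le_mul ?_ hA (by positivity) (by norm_num)
          exact pow_le_of_le_one (by norm_num) (by norm_num) hn.ne'
      _ = _ := by ring
  have h4 := sum_add_sum_compl (near θ.π r y) fun z => condLik θ' x z * labelProb θ' z
  have h5 := mul_lt_mul_of_pos_right hτn (mul_pos hcpos hApos)
  linarith

/-- The inequality t ≤ exp(t - 1) turns a lower bound on a product into one on a sum. Square roots
halve 3τ and prepare the affinity; unlike logarithms, they stay bounded where the estimated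
proportions vanish. -/
theorem le_sum_sqrt_div {θ θ' : Param Q} (hθ' : θ'.IsValid) {γ τ : ℝ} (hγ : 0 < γ)
    (hγα : ∀ q, γ ≤ θ.α q) {y z : Fin n → Fin Q}
    (h : Real.exp (-(3 * τ * n)) * labelProb θ y < labelProb θ' z) :
    (1 - 3 / 2 * τ) * n ≤ ∑ i, √(θ'.α (z i) / θ.α (y i)) := by
  have hα : ∀ q, 0 < θ.α q := fun q => hγ.trans_le (hγα q)
  have hpos : 0 < labelProb θ y := prod_pos fun i _ => hα _
  set t : Fin n → ℝ := fun i => √(θ'.α (z i) / θ.α (y i)) with ht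
  have ht0 : ∀ i, 0 ≤ t i := fun i => Real.sqrt_nonneg _
  have h1 : Real.exp (-(3 * τ * n)) < (∏ i, t i) ^ 2 := by
    have : (∏ i, t i) ^ 2 = labelProb θ' z / labelProb θ y := by
      rw [← prod_pow, labelProb, labelProb, ← prod_div_distrib]
      exact prod_congr rfl fun i _ => Real.sq_sqrt (div_nonneg (hθ'.α_nonneg _) (hα _).le)
    rw [this, lt_div_iff₀ hpos]
    exact h
  have h2 : ∏ i, t i ≤ Real.exp (∑ i, (t i - 1)) := by
    rw [Real.exp_sum]
    exact prod_le_prod (fun i _ => ht0 i) fun i _ => by linarith [Real.add_one_le_exp (t i - 1)]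
  have h3 := h1.trans_le (pow_le_pow_left₀ (prod_nonneg fun i _ => ht0 i) h2 2)
  rw [← Real.exp_nat_mul, Real.exp_lt_exp, sum_sub_distrib] at h3
  simp at h3
  linarith

/-- Starting from `le_sum_sqrt_div`, replacing `z` by `σ ∘ y` costs at most ηn/√γ, and replacing the
class sizes by nα_q costs at most κn/√γ per class. What remains is n times the affinity of the two
proportion vectors. -/
theorem exists_symmetry_of_lik_le {θ θ' : Param Q} (hθ : θ.IsValid) (hθ' : θ'.IsValid)
    {γ κ η τ : ℝ} (hγ : 0 < γ) (hγα : ∀ q, γ ≤ θ.α q) (hn : 0 < n)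
    (hτn : Real.exp (-τ * n) < 1 / 2) {x : Adj n} {y : Fin n → Fin Q}
    (hN : ∀ q, |(#{i | y i = q} : ℝ) - n * θ.α q| ≤ κ * n) (hc : condLik θ x y ≠ 0)
    (hnear : ∑ z ∈ near θ.π (η * n) y, condLik θ' x z ≤ Real.exp (2 * τ * n) * condLik θ x y)
    (hfar : ∑ z ∈ (near θ.π (η * n) y)ᶜ, condLik θ' x z ≤ (γ / 2) ^ n * condLik θ x y)
    (hL : ∑ z, condLik θ x z * labelProb θ z ≤ ∑ z, condLik θ' x z * labelProb θ' z) :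
    ∃ σ ∈ symmetries θ.π, ∀ q,
      |θ'.α (σ q) - θ.α q| ≤ 2 * √(2 * (3 / 2 * τ + (κ * Q + η) / √γ)) := by
  classical
  obtain ⟨z, hz, hlp⟩ := exists_near_of_lik_le hθ hθ' hγ hγα hn hτn hc hnear hfar hL
  obtain ⟨σ, hσ, hd⟩ := (mem_filter.1 hz).2
  refine ⟨σ, hσ, abs_sub_le_of_affinity (fun q => hθ'.α_nonneg _) (fun q => hθ.α_nonneg _)
    ((Equiv.sum_comp σ θ'.α).trans hθ'.α_sum) hθ.α_sum ?_⟩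
  have hα : ∀ q, 0 < θ.α q := fun q => hγ.trans_le (hγα q)
  have hsγ : 0 < √γ := Real.sqrt_pos.2 hγ
  have hn' : (0 : ℝ) < n := by exact_mod_cast hn
  have hr : ∀ a q, √(θ'.α a / θ.α q) ≤ 1 / √γ := by
    intro a q
    rw [one_div, ← Real.sqrt_inv, ← one_div]
    exact Real.sqrt_le_sqrt (div_le_div₀ zero_le_one (hθ'.α_le_one a) hγ (hγα q))
  have h1 := le_sum_sqrt_div hθ' hγ hγα hlp
  have h2 : ∑ i, √(θ'.α (z i) / θ.α (y i)) ≤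
      ∑ i, √(θ'.α (σ (y i)) / θ.α (y i)) + η * n * (1 / √γ) := by
    calc ∑ i, √(θ'.α (z i) / θ.α (y i))
        ≤ ∑ i, (√(θ'.α (σ (y i)) / θ.α (y i)) +
          (if z i ≠ (σ ∘ y) i then 1 else 0) * (1 / √γ)) := by
          refine sum_le_sum fun i _ => ?_
          split_ifs with h
          · linarith [hr (z i) (y i), Real.sqrt_nonneg (θ'.α (σ (y i)) / θ.α (y i))]
          · rw [not_not.1 h]; simp
      _ = ∑ i, √(θ'.α (σ (y i)) / θ.α (y i)) + hammingDist z (σ ∘ y) * (1 / √γ) := by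
          rw [sum_add_distrib, ← sum_mul, hammingDist, card_filter]
          push_cast
          rfl
      _ ≤ _ := by gcongr
  have h3 : ∑ i, √(θ'.α (σ (y i)) / θ.α (y i)) =
      ∑ q, (#{i | y i = q} : ℝ) * √(θ'.α (σ q) / θ.α q) := by
    rw [← sum_fiberwise (s := univ) y]
    refine sum_congr rfl fun q _ => ?_
    rw [sum_congr rfl fun i hi => by rw [(mem_filter.1 hi).2], sum_const, nsmul_eq_mul]
  have h4 : ∀ q, (#{i | y i = q} : ℝ) * √(θ'.α (σ q) / θ.α q) ≤
      n * √(θ'.α (σ q) * θ.α q) + κ * n * (1 / √γ) := by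
    intro q
    have hs : √(θ'.α (σ q) * θ.α q) = θ.α q * √(θ'.α (σ q) / θ.α q) := by
      rw [Real.sqrt_mul (hθ'.α_nonneg _), Real.sqrt_div (hθ'.α_nonneg _)]
      have := Real.sqrt_pos.2 (hα q)
      field_simp
      rw [Real.sq_sqrt (hα q).le]
    have hκn : 0 ≤ κ * n := (abs_nonneg _).trans (hN q)
    have h5 := mul_le_mul_of_nonneg_right (show (#{i | y i = q} : ℝ) ≤ n * θ.α q + κ * n by
      linarith [(abs_le.1 (hN q)).2]) (Real.sqrt_nonneg (θ'.α (σ q) / θ.α q))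
    have h6 := mul_le_mul_of_nonneg_left (hr (σ q) q) hκn
    rw [hs]
    linarith
  have h7 : ∑ q, (#{i | y i = q} : ℝ) * √(θ'.α (σ q) / θ.α q) ≤
      n * ∑ q, √(θ'.α (σ q) * θ.α q) + Q * (κ * n * (1 / √γ)) := by
    refine (sum_le_sum fun q _ => h4 q).trans (le_of_eq ?_)
    rw [sum_add_distrib, ← mul_sum]
    simp
  refine le_of_mul_le_mul_right ?_ hn'
  have h8 : (1 - (3 / 2 * τ + (κ * Q + η) / √γ)) * n =
      (1 - 3 / 2 * τ) * n - Q * (κ * n * (1 / √γ)) - η * n * (1 / √γ) := by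
    field_simp
    ring
  rw [h8]
  linarith

/-! ### Limits -/

theorem tendsto_const_mul_exp_neg_mul (C : ℝ) {a : ℝ} (ha : 0 < a) :
    Tendsto (fun n : ℕ => C * Real.exp (-a * n)) atTop (𝓝 0) := by
  have h : Tendsto (fun n : ℕ => Real.exp (-a * n)) atTop (𝓝 0) := by
    refine Real.tendsto_exp_atBot.comp ?_
    exact tendsto_natCast_atTop_atTop.const_mul_atTop_of_neg (by linarith)
  simpa using h.const_mul C

theorem tendsto_poly_mul_exp_neg_mul (A B : ℝ) (hA : 0 ≤ A) (hB : 0 ≤ B) (K : ℕ) {a : ℝ}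
    (ha : 0 < a) :
    Tendsto (fun n : ℕ => A * ((n : ℝ) ^ 2 + 1) ^ K * B * Real.exp (-a * n)) atTop (𝓝 0) := by
  have h1 : Tendsto (fun n : ℕ => A * B * 2 ^ K * ((n : ℝ) ^ (2 * K) * Real.exp (-a) ^ n))
      atTop (𝓝 0) := by
    have := tendsto_pow_const_mul_const_pow_of_lt_one (2 * K) (Real.exp_pos (-a)).le
      (Real.exp_lt_one_iff.2 (by linarith))
    simpa using this.const_mul (A * B * 2 ^ K)
  refine tendsto_of_tendsto_of_tendsto_of_le_of_le' tendsto_const_nhds h1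
    (Eventually.of_forall fun n => by positivity) ?_
  filter_upwards [eventually_ge_atTop 1] with n hn
  have hn' : (1 : ℝ) ≤ n := by exact_mod_cast hn
  have h2 : ((n : ℝ) ^ 2 + 1) ^ K ≤ 2 ^ K * (n : ℝ) ^ (2 * K) := by
    rw [pow_mul, ← mul_pow]
    exact pow_le_pow_left₀ (by positivity) (by nlinarith) K
  have h3 : Real.exp (-a * n) = Real.exp (-a) ^ n := by
    rw [← Real.exp_nat_mul]
    congr 1
    ring
  rw [h3]
  calc _ ≤ A * (2 ^ K * (n : ℝ) ^ (2 * K)) * B * Real.exp (-a) ^ n := by gcongr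
    _ = _ := by ring

/-- The negative quadratic exponent absorbs every factor that is exponential in n. -/
theorem tendsto_inv_pow_mul_pow_mul_exp {r : ℝ} (hr : 0 < r) (hQ : 0 < Q) {A B : ℝ} (hAB : A < B)
    (c : ℝ) :
    Tendsto (fun n : ℕ => (r ^ n)⁻¹ * (Q : ℝ) ^ n *
      Real.exp (A * n ^ 2 - B * n ^ 2 + c * n)) atTop (𝓝 0) := by
  have hb : 0 < (Q : ℝ) / r := div_pos (by exact_mod_cast hQ) hr
  have h : ∀ n : ℕ, (r ^ n)⁻¹ * (Q : ℝ) ^ n * Real.exp (A * n ^ 2 - B * n ^ 2 + c * n) =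
      Real.exp (n * ((Real.log (Q / r) + c) + -(B - A) * n)) := by
    intro n
    have h1 : (r ^ n)⁻¹ * (Q : ℝ) ^ n = Real.exp (n * Real.log (Q / r)) := by
      rw [Real.exp_nat_mul, Real.exp_log hb, div_pow]
      ring
    rw [h1, ← Real.exp_add]
    congr 1
    ring
  simp_rw [h]
  refine Real.tendsto_exp_atBot.comp ?_
  refine tendsto_natCast_atTop_atTop.atTop_mul_atBot₀ (tendsto_atBot_add_const_left _ _ ?_)
  exact tendsto_natCast_atTop_atTop.const_mul_atTop_of_neg (by linarith)

theorem tendsto_sqrt_log_div : Tendsto (fun n : ℕ => √(Real.log n) / n) atTop (𝓝 0) := by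
  have h1 : Tendsto (fun n : ℕ => 1 / √(n : ℝ)) atTop (𝓝 0) := by
    have := (Real.tendsto_sqrt_atTop.comp (tendsto_natCast_atTop_atTop (R := ℝ))).inv_tendsto_atTop
    refine this.congr fun n => ?_
    simp
  refine tendsto_of_tendsto_of_tendsto_of_le_of_le tendsto_const_nhds h1
    (fun n => by positivity) fun n => ?_
  rw [← Real.sqrt_div_self']
  gcongr
  exact Real.log_le_self (Nat.cast_nonneg n)

/-! ### Consistency -/

theorem IsMLE.lik_le {Θ : Set (Param Q)} {x : Adj n} {θ θ' : Param Q} (h : IsMLE Θ x θ')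
    (hθ : θ ∈ Θ) (hθ' : θ'.IsValid) :
    ∑ z, condLik θ x z * labelProb θ z ≤ ∑ z, condLik θ' x z * labelProb θ' z := by
  have h1 : logLik x θ ≤ logLik x θ' := h.2 hθ
  rw [logLik, logLik, ENNReal.log_le_log_iff, ENNReal.ofReal_le_ofReal_iff] at h1
  · exact h1
  · exact sum_nonneg fun z _ => mul_nonneg (hθ'.condLik_nonneg x z) (hθ'.labelProb_nonneg z)

theorem measurable_restrict {Ω : Type*} [MeasurableSpace Ω] {X : ℕ → ℕ → Ω → Bool}
    (hX : ∀ i j, Measurable (X i j)) (n : ℕ) : Measurable (restrict X n) :=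
  measurable_pi_lambda _ fun i => measurable_pi_lambda _ fun j => hX i j

/-- The maximum likelihood estimator of the group proportions is consistent up to the symmetries
of the connectivity matrix as soon as that of the connectivity matrix is consistent. -/
theorem tendsto_measure_not_exists_symmetry {Ω : Type*} [MeasurableSpace Ω] {μ : Measure Ω}
    [IsProbabilityMeasure μ] {γ : ℝ} (hγ : 0 < γ) (hQ : 0 < Q) {θs : Param Q}
    (hθs : θs.IsValid) (hA1 : θs.A1) (hγα : ∀ q, γ ≤ θs.α q)
    {Z : ℕ → Ω → Fin Q} {X : ℕ → ℕ → Ω → Bool} (hX : IsSBM μ θs Z X)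
    {Θ : Set (Param Q)} (hΘ : ∀ θ ∈ Θ, θ.IsValid) (hθsΘ : θs ∈ Θ) {est : ∀ n : ℕ, Adj n → Param Q}
    (hMLE : Tendsto (fun n : ℕ =>
      μ {ω | IsMLE Θ (restrict X n ω) (est n (restrict X n ω))}) atTop (𝓝 1))
    (hπ : ∀ δ : ℝ, 0 < δ → Tendsto (fun n : ℕ =>
      μ {ω | δ < ‖(est n (restrict X n ω)).π - θs.π‖}) atTop (𝓝 0)) {ε : ℝ} (hε : 0 < ε) :
    Tendsto (fun n : ℕ => μ {ω | ¬ ∃ σ ∈ symmetries θs.π, ∀ q,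
      |(est n (restrict X n ω)).α (σ q) - θs.α q| < ε}) atTop (𝓝 0) := by
  have hQ' : (0 : ℝ) < Q := by exact_mod_cast hQ
  have hγ1 : γ ≤ 1 := (hγα ⟨0, hQ⟩).trans (hθs.α_le_one _)
  have hsγ : 0 < √γ := Real.sqrt_pos.2 hγ
  obtain ⟨c, hc, hgap⟩ := hθs.exists_affinity_gap
  -- ρ is the allowed affinity defect. It is shared equally between 3τ/2, κ₁Q/√γ and η/√γ.
  obtain ⟨ρ, hρ, hρε⟩ : ∃ ρ : ℝ, 0 < ρ ∧ 2 * √(2 * ρ) < ε := by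
    refine ⟨ε ^ 2 / 16, by positivity, ?_⟩
    have : √(2 * (ε ^ 2 / 16)) < ε / 2 := by
      rw [Real.sqrt_lt' (by positivity)]
      nlinarith [sq_nonneg ε, sq_pos_of_pos hε]
    linarith
  obtain ⟨τ, hτ, hτρ⟩ : ∃ τ : ℝ, 0 < τ ∧ 3 / 2 * τ ≤ ρ / 3 := ⟨ρ / 6, by positivity, by linarith⟩
  obtain ⟨κ₁, hκ₁, hκ₁γ, hκ₁ρ⟩ : ∃ κ : ℝ, 0 < κ ∧ κ ≤ γ / 2 ∧ κ * Q ≤ √γ * (ρ / 3) := by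
    refine ⟨min (γ / 2) (√γ * (ρ / 3) / Q), by positivity, min_le_left _ _, ?_⟩
    rw [← le_div_iff₀ hQ']
    exact min_le_right _ _
  -- s has to be fixed before η, so that the near-vector rate sη + Q exp(-s) is at most τ.
  obtain ⟨s, hs, hsτ⟩ : ∃ s : ℝ, 0 < s ∧ Q * Real.exp (-s) < τ / 2 := by
    have h1 : Tendsto (fun s : ℝ => Q * Real.exp (-s)) atTop (𝓝 (Q * 0)) :=
      (Real.tendsto_exp_neg_atTop_nhds_zero).const_mul _
    rw [mul_zero] at h1
    exact ((eventually_gt_atTop 0).and (h1.eventually_lt_const (by positivity))).exists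
  obtain ⟨η, hη, hητ, hηρ⟩ : ∃ η : ℝ, 0 < η ∧ s * η ≤ τ / 2 ∧ η ≤ √γ * (ρ / 3) := by
    refine ⟨min (τ / 2 / s) (√γ * (ρ / 3)), by positivity, ?_, min_le_right _ _⟩
    rw [mul_comm, ← le_div_iff₀ hs]
    exact min_le_left _ _
  obtain ⟨κ, hκ, hκη, hκγ⟩ : ∃ κ : ℝ, 0 < κ ∧ κ * Q ^ 2 ≤ η ∧ κ * Q ≤ γ / 2 := by
    refine ⟨min (η / Q ^ 2) (γ / 2 / Q), by positivity, ?_, ?_⟩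
    · rw [← le_div_iff₀ (by positivity)]; exact min_le_left _ _
    · rw [← le_div_iff₀ hQ']; exact min_le_right _ _
  -- The error in π must cost less, at the scale n², than the mismatches gain.
  obtain ⟨δ, hδ, hδc⟩ : ∃ δ : ℝ, 0 < δ ∧ 2 * √δ < c * κ ^ 2 := by
    refine ⟨(c * κ ^ 2 / 4) ^ 2, by positivity, ?_⟩
    rw [Real.sqrt_sq (by positivity)]
    have : 0 < c * κ ^ 2 := by positivity
    linarith
  -- The bad events: atypical class sizes, too much weight on near vectors, and too much on far
  -- ones. Two more are added below: failure to maximize, and an error in π larger than δ.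
  let E₁ : ∀ n : ℕ, (Fin n → Fin Q) → Adj n → Prop := fun n y _ =>
    ∃ q, κ₁ * n < |(#{i | y i = q} : ℝ) - n * θs.α q|
  let E₂ : ∀ n : ℕ, (Fin n → Fin Q) → Adj n → Prop := fun n y x =>
    (est n x).IsValid ∧ (condLik θs x y = 0 ∨
      Real.exp (2 * τ * n) * condLik θs x y < ∑ z ∈ near θs.π (η * n) y, condLik (est n x) x z)
  let E₃ : ∀ n : ℕ, (Fin n → Fin Q) → Adj n → Prop := fun n y x =>
    (est n x).IsValid ∧ (∀ q l, |(est n x).π q l - θs.π q l| ≤ δ) ∧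
      (∀ q, κ * Q * n ≤ #{i | y i = q}) ∧
      (γ / 2) ^ n * condLik θs x y < ∑ z ∈ (near θs.π (η * n) y)ᶜ, condLik (est n x) x z
  have hE : ∀ E : ∀ n : ℕ, (Fin n → Fin Q) → Adj n → Prop, ∀ b : ℕ → ℝ,
      Tendsto b atTop (𝓝 0) → (∀ᶠ n in atTop, prob θs (E n) ≤ b n) →
      Tendsto (fun n : ℕ => μ {ω | E n (fun i => Z i ω) (restrict X n ω)}) atTop (𝓝 0) := by
    intro E b hb hEb
    have hb' : Tendsto (fun n => ENNReal.ofReal (b n)) atTop (𝓝 0) := by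
      simpa using ENNReal.tendsto_ofReal hb
    refine tendsto_of_tendsto_of_tendsto_of_le_of_le' tendsto_const_nhds hb'
      (Eventually.of_forall fun _ => zero_le) ?_
    filter_upwards [hEb] with n hn
    exact (hX.measure_le hθs (E n)).trans (ENNReal.ofReal_le_ofReal hn)
  have h₁ := hE E₁ _ (tendsto_const_mul_exp_neg_mul (2 * Q) (by positivity : 0 < κ₁ ^ 2 / 4))
    (Eventually.of_forall fun n => prob_class_size_le hθs hκ₁.le (by linarith))
  have h₂ := hE E₂ _ (tendsto_poly_mul_exp_neg_mul Q.factorial (Real.exp 1) (by positivity)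
      (by positivity) (Q * Q) hτ) (by
    filter_upwards [eventually_gt_atTop 0] with n hn
    exact prob_near_le hθs hn (est n) hs.le (by linarith))
  have h₃ := hE E₃ _ (tendsto_inv_pow_mul_pow_mul_exp (half_pos hγ) hQ hδc c)
    (Eventually.of_forall fun n => by
      have := prob_far_le (n := n) (ρ := (γ / 2) ^ n) hθs hA1 hQ (est n) hc.le hδ.le
        (by positivity) (pow_le_one₀ (by positivity) (by linarith)) hκ.le hκη hgap
      rwa [← mul_assoc c] at this)
  have h₄ : Tendsto (fun n : ℕ =>
      μ {ω | ¬ IsMLE Θ (restrict X n ω) (est n (restrict X n ω))}) atTop (𝓝 0) := by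
    have h1 := ENNReal.Tendsto.sub (tendsto_const_nhds (x := (1 : ENNReal)) (f := atTop)) hMLE
      (Or.inl ENNReal.one_ne_top)
    rw [tsub_self] at h1
    refine h1.congr fun n => ?_
    rw [← prob_compl_eq_one_sub]
    · rfl
    · exact measurable_restrict hX.measurable_edge n
        (MeasurableSet.of_discrete (s := {x : Adj n | IsMLE Θ x (est n x)}))
  have hsum := (((h₁.add h₂).add h₃).add h₄).add (hπ δ hδ)
  simp only [add_zero] at hsum
  refine tendsto_of_tendsto_of_tendsto_of_le_of_le' tendsto_const_nhds hsum
    (Eventually.of_forall fun _ => zero_le) ?_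
  have hτn : ∀ᶠ n : ℕ in atTop, Real.exp (-τ * n) < 1 / 2 := by
    have := tendsto_const_mul_exp_neg_mul 1 hτ
    simp only [one_mul] at this
    exact this.eventually_lt_const (by norm_num)
  filter_upwards [eventually_gt_atTop 0, hτn] with n hn hτn
  refine (measure_mono ?_).trans ((measure_union_le _ _).trans (add_le_add ((measure_union_le _ _).trans
    (add_le_add ((measure_union_le _ _).trans (add_le_add (measure_union_le _ _) le_rfl)) le_rfl))
    le_rfl))
  intro ω hω
  by_contra hgood
  simp only [Set.mem_union, Set.mem_ofPred_eq, not_or, not_not, not_lt] at hgood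
  obtain ⟨⟨⟨⟨g₁, g₂⟩, g₃⟩, g₄⟩, g₅⟩ := hgood
  set x := restrict X n ω
  set y : Fin n → Fin Q := fun i => Z i ω
  have hval : (est n x).IsValid := hΘ _ g₄.1
  simp only [E₁, not_exists, not_lt] at g₁
  simp only [E₂, not_and, not_or, not_lt] at g₂
  simp only [E₃, not_and, not_lt] at g₃
  obtain ⟨hcl, hnear⟩ := g₂ hval
  have hfar := g₃ hval (fun q l => by
      rw [← Real.norm_eq_abs]
      exact ((norm_le_pi_norm (((est n x).π - θs.π) q) l).trans
        -- Each class has at least (γ - κ₁)n ≥ γn/2 ≥ κQn vertices.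
        (norm_le_pi_norm ((est n x).π - θs.π) q)).trans g₅) fun q => by
    have h1 := (abs_le.1 (g₁ q)).1
    have h2 : γ * n ≤ θs.α q * n := by gcongr; exact hγα q
    have h3 : κ₁ * n ≤ γ / 2 * n := by gcongr
    have h4 : κ * Q * n ≤ γ / 2 * n := by gcongr
    linarith
  obtain ⟨σ, hσ, h⟩ := exists_symmetry_of_lik_le hθs hval hγ hγα hn hτn g₁ hcl hnear hfar
    (g₄.lik_le hθsΘ hval)
  refine hω ⟨σ, hσ, fun q => (h q).trans_lt (lt_of_le_of_lt ?_ hρε)⟩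
  have h5 : (κ₁ * Q + η) / √γ ≤ 2 * (ρ / 3) := by
    rw [div_le_iff₀ hsγ]
    linarith
  gcongr
  linarith

/-- A distance that induces the usual topology is small at points that are close in each
coordinate. -/
theorem exists_forall_dist_lt {ι : Type*} [Fintype ι] (d : MetricSpace (ι → ℝ))
    (hd : d.toPseudoMetricSpace.toUniformSpace.toTopologicalSpace = Pi.topologicalSpace)
    (a : ι → ℝ) {ε : ℝ} (hε : 0 < ε) :
    ∃ r > 0, ∀ v : ι → ℝ, (∀ i, |v i - a i| < r) → d.dist v a < ε := by
  have h1 := @Metric.ball_mem_nhds _ d.toPseudoMetricSpace a ε hε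
  rw [hd] at h1
  obtain ⟨r, hr, hsub⟩ := Metric.mem_nhds_iff.1 h1
  refine ⟨r, hr, fun v hv => ?_⟩
  exact hsub ((dist_pi_lt_iff hr).2 fun i => by rw [Real.dist_eq]; exact hv i)

end SBM

theorem theorem3p3 {Ω : Type*} [MeasurableSpace Ω] (μ : Measure Ω) [IsProbabilityMeasure μ]
    (Q : ℕ) (ζ γ : ℝ) (hζ : 0 < ζ) (hγ : 0 < γ) (hγQ : γ < 1 / (Q : ℝ))
    -- the true parameter
    (θs : SBM.Param Q) (hθs : θs.IsValid) (hA1 : θs.A1) (hA2 : θs.A2 ζ) (hA3 : θs.A3 γ)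
    -- the random graph
    (Z : ℕ → Ω → Fin Q) (X : ℕ → ℕ → Ω → Bool) (hX : SBM.IsSBM μ θs Z X)
    -- the set of parameters over which the likelihood is maximized
    (Θ : Set (SBM.Param Q)) (hΘ : ∀ θ ∈ Θ, θ.IsValid) (hθsΘ : θs ∈ Θ)
    -- the maximum likelihood estimator
    (est : ∀ n : ℕ, SBM.Adj n → SBM.Param Q)
    (hMLE : Tendsto (fun n : ℕ =>
      μ {ω | SBM.IsMLE Θ (SBM.restrict X n ω) (est n (SBM.restrict X n ω))}) atTop (𝓝 1))
    -- the rate of convergence of the estimator of the connectivity matrix (in the sup norm)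
    (hrate : ∀ ε : ℝ, 0 < ε → Tendsto (fun n : ℕ =>
      μ {ω | ε * (√(Real.log n) / n) < ‖(est n (SBM.restrict X n ω)).π - θs.π‖}) atTop (𝓝 0))
    -- any distance that induces the usual topology
    (d : MetricSpace (Fin Q → ℝ))
    (hd : d.toPseudoMetricSpace.toUniformSpace.toTopologicalSpace = Pi.topologicalSpace) :
    (∀ ε : ℝ, 0 < ε → Tendsto (fun n : ℕ =>
      μ {ω | ∀ σ ∈ SBM.symmetries θs.π,
        ε < d.dist (fun q => (est n (SBM.restrict X n ω)).α (σ q)) θs.α}) atTop (𝓝 0)) ∧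
    ((∀ σ ∈ SBM.symmetries θs.π, ∀ q, θs.α (σ q) = θs.α q) →
      ∀ ε : ℝ, 0 < ε → Tendsto (fun n : ℕ =>
        μ {ω | ε < d.dist (est n (SBM.restrict X n ω)).α θs.α}) atTop (𝓝 0)) := by
  have hQ : 0 < Q := by
    rcases Nat.eq_zero_or_pos Q with rfl | h
    -- For Q = 0 the convention 1/0 = 0 makes the bounds on γ contradictory.
    · simp at hγQ
      linarith
    · exact h
  have hπ : ∀ δ : ℝ, 0 < δ → Tendsto (fun n : ℕ =>
      μ {ω | δ < ‖(est n (SBM.restrict X n ω)).π - θs.π‖}) atTop (𝓝 0) := by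
    intro δ hδ
    refine tendsto_of_tendsto_of_tendsto_of_le_of_le' tendsto_const_nhds (hrate 1 one_pos)
      (Eventually.of_forall fun _ => zero_le) ?_
    filter_upwards [SBM.tendsto_sqrt_log_div.eventually_lt_const hδ] with n hn
    refine measure_mono fun ω hω => ?_
    simp only [Set.mem_ofPred_eq, one_mul] at hω ⊢
    exact hn.trans hω
  have key : ∀ ε : ℝ, 0 < ε → Tendsto (fun n : ℕ => μ {ω | ¬ ∃ σ ∈ SBM.symmetries θs.π, ∀ q,
      |(est n (SBM.restrict X n ω)).α (σ q) - θs.α q| < ε}) atTop (𝓝 0) := fun ε hε =>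
    SBM.tendsto_measure_not_exists_symmetry hγ hQ hθs hA1 (fun q => (hA3 q).1) hX hΘ hθsΘ hMLE
      hπ hε
  refine ⟨fun ε hε => ?_, fun hsym ε hε => ?_⟩
  all_goals
    obtain ⟨r, hr, hball⟩ := SBM.exists_forall_dist_lt d hd θs.α hε
    refine tendsto_of_tendsto_of_tendsto_of_le_of_le tendsto_const_nhds (key r hr)
      (fun _ => zero_le) fun n => measure_mono fun ω hω => ?_
    rintro ⟨σ, hσ, h⟩
  · exact lt_asymm (hω σ hσ) (hball _ h)
  · refine lt_asymm hω (hball _ fun q => ?_)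
    -- Evaluated at σ⁻¹(q), the bound compares the estimate at q with α* at σ⁻¹(q), which equals α*
    -- at q by invariance.
    have h1 := h (σ.symm q)
    have h2 := hsym σ hσ (σ.symm q)
    rw [Equiv.apply_symm_apply] at h1 h2
    rwa [h2]
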